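/- **Setting.** Let $n\ge 1$, let $\Omega\subset\mathbb R^n$ be a bounded open set with Lipschitz boundary, $\Gamma\subseteq\partial\Omega$ a measurable part of its boundary, and $T>0$. All spaces are real. *The system.* Let $A=\sum_{i,j=1}^n\partial_i(a_{ij}\,\partial_j\,\cdot)$ with smooth coefficients $a_{ij}$, not depending on time, such that $\sum_{i,j}a_{ij}(\xi)v_iv_j\ge\alpha|v|^2$ for some $\alpha>0$ and all $\xi\in\Omega$, $v\in\mathbb R^n$. Let the state space $X$ be a Hilbert space of functions on $\Omega$, continuously embedded in $L^2(\Omega)$ (for example $X=L^2(\Omega)$), and let $A$ act in $X$ with the Dirichlet boundary condition, on the domain $D(A)=\{x\in X\cap H^2(\Omega)\cap H^1_0(\Omega): Ax\in X\}$. Assume that $A$ is self-adjoint in $X$, has a compact resolvent and generates a strongly continuous semigroup $(S_A(t))_{t\ge0}$ on $X$. The system is $\partial x/\partial t=Ax$ on $\Omega$, $x=0$ on $\partial\Omega$, $x(0)=x_0$, so that $x(t)=S_A(t)x_0$. *Sensors.* A sensor is a pair $(D,f)$ of a nonempty set $D\subseteq\overline\Omega$ and a linear functional $f$ on $D(A)$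 that is continuous for the graph norm of $A$ and satisfies $f(x)=0$ whenever $x$ vanishes in a neighbourhood of $D$ (for example $f(x)=\int_D x f$ or $f(x)=x(b)$). The system is observed through $q$ sensors $(D_i,f_i)$ ($q=1$ for a single sensor), with output $y(t)=Cx(t)$, $Cx=(f_1(x),\dots,f_q(x))$. Put $\mathcal O=L^2(0,T;\mathbb R^q)$, and assume that $Kx=CS_A(\cdot)x$, $x\in D(A)$, extends to a bounded operator $K:X\to\mathcal O$. Let $K^*:\mathcal O\to X$ be its adjoint. *The operator $H$.* Let $H^{1/2}(\Gamma)$ be the Hilbert space of the $g\in L^2(\Gamma)$ for the surface measure $\sigma$ with $\iint_{\Gamma\times\Gamma}|g(x)-g(y)|^2|x-y|^{-n}\,d\sigma(x)\,d\sigma(y)<\infty$, let $\nabla$ be the gradient from $H^2(\Omega)$ to $(H^1(\Omega))^n$, let $\gamma:(H^1(\Omega))^n\to(H^{1/2}(\partial\Omega))^n$ be the trace operator and $\chi_\Gamma:(H^{1/2}(\partial\Omega))^n\to(H^{1/2}(\Gamma))^n$ the restriction to $\Gamma$, and let $$H=\chi_\Gamma\,\gamma\,\nabla K^*:\ \mathcal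 O\supseteq D(H)\to(H^{1/2}(\Gamma))^n,\qquad D(H)=\{y\in\mathcal O: K^*y\in H^2(\Omega)\}.$$ The sensors are called *boundary gradient strategic on $\Gamma$* ($\Gamma_G$-strategic) if the observed system is weakly $\Gamma_G$-observable, that is, if $\overline{\operatorname{Im}H}=(H^{1/2}(\Gamma))^n$. **Corollary 3.4.** The operator $H$ is densely defined, so that it has an adjoint $H^*$, and the sensors are $\Gamma_G$-strategic if and only if the operator $N_\Gamma=HH^*$, with domain $\{x\in D(H^*): H^*x\in D(H)\}$, is positive definite: it is symmetric and $\langle N_\Gamma x,x\rangle>0$ for all $x\ne0$ in its domain. -/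

import Mathlib

open MeasureTheory Set Filter Topology
open scoped ContDiff InnerProductSpace NNReal ENNReal LinearPMap

noncomputable section

namespace BoundaryGradient

/-- The Euclidean space `ℝⁿ`. -/
abbrev E (n : ℕ) := EuclideanSpace ℝ (Fin n)

/-! ### Domains and Sobolev spaces on the domain -/

/-- `Ω` has a Lipschitz boundary: near each boundary point, and in a suitable direction `v`, it is
the region above the graph of a Lipschitz function of the component orthogonal to `v`. -/
def HasLipschitzBoundary {n : ℕ} (Ω : Set (E n)) : Prop :=
  ∀ x ∈ frontier Ω, ∃ v : E n, ‖v‖ = 1 ∧ ∃ h : E n → ℝ, (∃ L : ℝ≥0, LipschitzWith L h) ∧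
    ∃ r > 0, ∀ y ∈ Metric.ball x r, (y ∈ Ω ↔ h (y - ⟪v, y⟫_ℝ • v) < ⟪v, y⟫_ℝ)

/-- Test functions on `Ω`: smooth with compact support inside `Ω`. -/
structure IsTest {n : ℕ} (Ω : Set (E n)) (φ : E n → ℝ) : Prop where
  smooth : ContDiff ℝ ∞ φ
  compact : HasCompactSupport φ
  supp : tsupport φ ⊆ Ω

/-- Classical partial derivative in the `i`-th coordinate. -/
def partialD {n : ℕ} (i : Fin n) (φ : E n → ℝ) (x : E n) : ℝ :=
  fderiv ℝ φ x (EuclideanSpace.single i 1)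

/-- `L²(Ω)` for the Lebesgue measure. -/
abbrev L2 {n : ℕ} (Ω : Set (E n)) := Lp ℝ 2 (volume.restrict Ω)

/-- `v` is the weak partial derivative `∂ᵢ u` on `Ω`. -/
def IsWeakDeriv {n : ℕ} (Ω : Set (E n)) (i : Fin n) (u v : L2 Ω) : Prop :=
  ∀ φ : E n → ℝ, IsTest Ω φ → ∫ x in Ω, u x * partialD i φ x = -∫ x in Ω, v x * φ x

lemma integrable_mul_cc {n : ℕ} {Ω : Set (E n)} (u : L2 Ω) {ψ : E n → ℝ} (hc : Continuous ψ)
    (hs : HasCompactSupport ψ) : Integrable (fun x => u x * ψ x) (volume.restrict Ω) :=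
  MemLp.integrable_mul (p := 2) (q := 2) (Lp.memLp u)
    ((hc.memLp_of_hasCompactSupport hs).restrict Ω)

lemma integral_add_cc {n : ℕ} {Ω : Set (E n)} (u v : L2 Ω) {ψ : E n → ℝ} (hc : Continuous ψ)
    (hs : HasCompactSupport ψ) :
    ∫ x in Ω, (u + v) x * ψ x = (∫ x in Ω, u x * ψ x) + ∫ x in Ω, v x * ψ x := by
  rw [← integral_add (integrable_mul_cc u hc hs) (integrable_mul_cc v hc hs)]
  refine integral_congr_ae ?_
  filter_upwards [Lp.coeFn_add u v] with x hx
  rw [hx, Pi.add_apply, add_mul]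

lemma integral_smul_cc {n : ℕ} {Ω : Set (E n)} (c : ℝ) (u : L2 Ω) (ψ : E n → ℝ) :
    ∫ x in Ω, (c • u) x * ψ x = c * ∫ x in Ω, u x * ψ x := by
  rw [← integral_const_mul]
  refine integral_congr_ae ?_
  filter_upwards [Lp.coeFn_smul c u] with x hx
  rw [hx, Pi.smul_apply, smul_eq_mul, mul_assoc]

lemma integral_zero_cc {n : ℕ} {Ω : Set (E n)} (ψ : E n → ℝ) :
    ∫ x in Ω, (0 : L2 Ω) x * ψ x = 0 := by
  simpa using integral_smul_cc (Ω := Ω) 0 0 ψ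

lemma IsTest.continuous_partialD {n : ℕ} {Ω : Set (E n)} {φ : E n → ℝ} (h : IsTest Ω φ)
    (i : Fin n) : Continuous (partialD i φ) :=
  (h.smooth.continuous_fderiv (by simp)).clm_apply continuous_const

lemma IsTest.compact_partialD {n : ℕ} {Ω : Set (E n)} {φ : E n → ℝ} (h : IsTest Ω φ)
    (i : Fin n) : HasCompactSupport (partialD i φ) :=
  h.compact.fderiv_apply ℝ _

lemma IsWeakDeriv.add {n : ℕ} {Ω : Set (E n)} {i : Fin n} {u v u' v' : L2 Ω}
    (h : IsWeakDeriv Ω i u v) (h' : IsWeakDeriv Ω i u' v') :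
    IsWeakDeriv Ω i (u + u') (v + v') := by
  intro φ hφ
  rw [integral_add_cc _ _ (hφ.continuous_partialD i) (hφ.compact_partialD i),
    integral_add_cc _ _ hφ.smooth.continuous hφ.compact, h φ hφ, h' φ hφ]
  ring

lemma IsWeakDeriv.smul {n : ℕ} {Ω : Set (E n)} {i : Fin n} {u v : L2 Ω} (c : ℝ)
    (h : IsWeakDeriv Ω i u v) : IsWeakDeriv Ω i (c • u) (c • v) := by
  intro φ hφ
  rw [integral_smul_cc, integral_smul_cc, h φ hφ]
  ring

lemma IsWeakDeriv.zero {n : ℕ} (Ω : Set (E n)) (i : Fin n) : IsWeakDeriv Ω i 0 0 := by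
  intro φ hφ
  rw [integral_zero_cc, integral_zero_cc, neg_zero]

/-- `H¹(Ω)`, realized as the space of pairs `(u, ∇u)` inside `L²(Ω) × L²(Ω)ⁿ`, so that the inner
product is `∫ u v + ∑ᵢ ∫ ∂ᵢu ∂ᵢv`. -/
def H1 {n : ℕ} (Ω : Set (E n)) :
    Submodule ℝ (WithLp 2 (L2 Ω × PiLp 2 (fun _ : Fin n => L2 Ω))) where
  carrier := {p | ∀ i, IsWeakDeriv Ω i p.fst (p.snd i)}
  add_mem' hp hq i := (hp i).add (hq i)
  zero_mem' i := IsWeakDeriv.zero Ω i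
  smul_mem' c _ hp i := (hp i).smul c

/-- The function underlying an element of `H¹(Ω)`. -/
def fn {n : ℕ} {Ω : Set (E n)} (u : H1 Ω) : L2 Ω := u.1.fst

/-- The weak partial derivative `∂ᵢ u` of an element of `H¹(Ω)`. -/
def deriv1 {n : ℕ} {Ω : Set (E n)} (u : H1 Ω) (i : Fin n) : L2 Ω := u.1.snd i

lemma fn_add {n : ℕ} {Ω : Set (E n)} (u v : H1 Ω) : fn (u + v) = fn u + fn v := rfl

lemma fn_smul {n : ℕ} {Ω : Set (E n)} (c : ℝ) (u : H1 Ω) : fn (c • u) = c • fn u := rfl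

lemma fn_zero {n : ℕ} {Ω : Set (E n)} : fn (0 : H1 Ω) = 0 := rfl

lemma deriv1_add {n : ℕ} {Ω : Set (E n)} (u v : H1 Ω) (i : Fin n) :
    deriv1 (u + v) i = deriv1 u i + deriv1 v i := rfl

lemma deriv1_smul {n : ℕ} {Ω : Set (E n)} (c : ℝ) (u : H1 Ω) (i : Fin n) :
    deriv1 (c • u) i = c • deriv1 u i := rfl

lemma deriv1_zero {n : ℕ} {Ω : Set (E n)} (i : Fin n) : deriv1 (0 : H1 Ω) i = 0 := rfl

/-- The elements of `H¹(Ω)` given by test functions. -/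
def testH1 {n : ℕ} (Ω : Set (E n)) : Submodule ℝ (H1 Ω) where
  carrier := {u | ∃ φ, IsTest Ω φ ∧ fn u =ᵐ[volume.restrict Ω] φ}
  add_mem' := by
    rintro u v ⟨φ, hφ, hu⟩ ⟨ψ, hψ, hv⟩
    refine ⟨φ + ψ, ⟨hφ.smooth.add hψ.smooth, hφ.compact.add hψ.compact, ?_⟩,
      (Lp.coeFn_add (fn u) (fn v)).trans (hu.add hv)⟩
    exact (tsupport_add φ ψ).trans (union_subset hφ.supp hψ.supp)
  zero_mem' := ⟨0, ⟨contDiff_const, HasCompactSupport.zero, by simp [tsupport]⟩,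
    Lp.coeFn_zero ℝ 2 _⟩
  smul_mem' := by
    rintro c u ⟨φ, hφ, hu⟩
    refine ⟨c • φ, ⟨hφ.smooth.const_smul c, hφ.compact.smul_left (f := fun _ => c), ?_⟩,
      (Lp.coeFn_smul c (fn u)).trans (hu.const_smul c)⟩
    exact (closure_mono (Function.support_const_smul_subset c φ)).trans hφ.supp

/-- `H¹₀(Ω)`, the closure of the test functions in `H¹(Ω)`. -/
def H10 {n : ℕ} (Ω : Set (E n)) : Submodule ℝ (H1 Ω) := (testH1 Ω).topologicalClosure

/-- The graph of `u ↦ ∇u`, for the functions whose gradient is in `(H¹(Ω))ⁿ`. -/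
def gradGraph {n : ℕ} (Ω : Set (E n)) :
    Submodule ℝ (L2 Ω × PiLp 2 (fun _ : Fin n => H1 Ω)) where
  carrier := {p | ∀ i, IsWeakDeriv Ω i p.1 (fn (p.2 i))}
  add_mem' hp hq i := (hp i).add (hq i)
  zero_mem' i := IsWeakDeriv.zero Ω i
  smul_mem' c _ hp i := (hp i).smul c

/-- The gradient `∇`, with values in `(H¹(Ω))ⁿ`. Its domain is `H²(Ω)`: the functions in `L²(Ω)`
whose weak derivatives of order at most two are in `L²(Ω)`. -/
def grad {n : ℕ} (Ω : Set (E n)) : L2 Ω →ₗ.[ℝ] PiLp 2 (fun _ : Fin n => H1 Ω) :=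
  (gradGraph Ω).toLinearPMap

/-! ### Composition of operators -/

/-- The composition `B A` of partially defined operators, with its natural domain
`{x ∈ D(A) | A x ∈ D(B)}`. -/
def compPMap {F₁ F₂ F₃ : Type*} [AddCommGroup F₁] [Module ℝ F₁] [AddCommGroup F₂] [Module ℝ F₂]
    [AddCommGroup F₃] [Module ℝ F₃] (B : F₂ →ₗ.[ℝ] F₃) (A : F₁ →ₗ.[ℝ] F₂) : F₁ →ₗ.[ℝ] F₃ where
  domain :=
    { carrier := {x | ∃ h : x ∈ A.domain, A ⟨x, h⟩ ∈ B.domain}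
      add_mem' := by
        rintro x y ⟨hx, hx'⟩ ⟨hy, hy'⟩
        refine ⟨add_mem hx hy, ?_⟩
        rw [← AddMemClass.mk_add_mk _ _ _ hx hy, A.map_add]
        exact add_mem hx' hy'
      zero_mem' := ⟨zero_mem _, by
        have h : (⟨0, zero_mem _⟩ : A.domain) = 0 := rfl
        rw [h, A.map_zero]
        exact zero_mem _⟩
      smul_mem' := by
        rintro c x ⟨hx, hx'⟩
        refine ⟨Submodule.smul_mem _ c hx, ?_⟩
        have h : (⟨c • x, Submodule.smul_mem _ c hx⟩ : A.domain) = c • ⟨x, hx⟩ := rfl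
        rw [h, A.map_smul]
        exact Submodule.smul_mem _ c hx' }
  toFun :=
    { toFun := fun x => B ⟨A ⟨x, x.2.choose⟩, x.2.choose_spec⟩
      map_add' := fun x y => by
        rw [← B.map_add]
        congr 1
        exact Subtype.ext (A.map_add ⟨x, x.2.choose⟩ ⟨y, y.2.choose⟩)
      map_smul' := fun c x => by
        rw [RingHom.id_apply, ← B.map_smul]
        congr 1
        exact Subtype.ext (A.map_smul c ⟨x, x.2.choose⟩) }

/-- Componentwise action of a continuous linear map. -/
def piMapL2 {F G : Type*} [NormedAddCommGroup F] [NormedSpace ℝ F] [NormedAddCommGroup G]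
    [NormedSpace ℝ G] (n : ℕ) (S : F →L[ℝ] G) :
    PiLp 2 (fun _ : Fin n => F) →L[ℝ] PiLp 2 (fun _ : Fin n => G) :=
  (PiLp.continuousLinearEquiv 2 ℝ (fun _ : Fin n => G)).symm.toContinuousLinearMap ∘L
    ContinuousLinearMap.pi fun i => S ∘L PiLp.proj 2 (fun _ : Fin n => F) i

/-! ### The trace spaces -/

/-- The surface measure of `∂Ω`. -/
def surf {n : ℕ} (Ω : Set (E n)) : Measure (E n) :=
  (Measure.euclideanHausdorffMeasure (n - 1) : Measure (E n)).restrict (frontier Ω)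

/-- The measure `|x - y|⁻ⁿ dσ(x) dσ(y)` on `∂Ω × ∂Ω`. -/
def surfKernel {n : ℕ} (Ω : Set (E n)) : Measure (E n × E n) :=
  ((surf Ω).prod (surf Ω)).withDensity fun p => ENNReal.ofReal ((‖p.1 - p.2‖ ^ n)⁻¹)

lemma quasi_fst {n : ℕ} (Ω Γ : Set (E n)) : Measure.QuasiMeasurePreserving Prod.fst
    ((surfKernel Ω).restrict (Γ ×ˢ Γ)) ((surf Ω).restrict Γ) := by
  refine ⟨measurable_fst, Measure.AbsolutelyContinuous.mk fun s hs h => ?_⟩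
  rw [Measure.restrict_apply hs] at h
  rw [Measure.map_apply measurable_fst hs, Measure.restrict_apply (measurable_fst hs)]
  refine withDensity_absolutelyContinuous _ _ (measure_mono_null ?_
    (Measure.quasiMeasurePreserving_fst.preimage_null h))
  exact fun p hp => ⟨hp.1, hp.2.1⟩

lemma quasi_snd {n : ℕ} (Ω Γ : Set (E n)) : Measure.QuasiMeasurePreserving Prod.snd
    ((surfKernel Ω).restrict (Γ ×ˢ Γ)) ((surf Ω).restrict Γ) := by
  refine ⟨measurable_snd, Measure.AbsolutelyContinuous.mk fun s hs h => ?_⟩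
  rw [Measure.restrict_apply hs] at h
  rw [Measure.map_apply measurable_snd hs, Measure.restrict_apply (measurable_snd hs)]
  refine withDensity_absolutelyContinuous _ _ (measure_mono_null ?_
    (Measure.quasiMeasurePreserving_snd.preimage_null h))
  exact fun p hp => ⟨hp.1, hp.2.2⟩

/-- The space `H^{1/2}(Γ)` for `Γ ⊆ ∂Ω`: the functions `g ∈ L²(Γ)` with
`∬_{Γ × Γ} |g(x) - g(y)|² / |x - y|ⁿ dσ(x) dσ(y) < ∞`. It is realized as the space of pairs `(g, G)`
with `G(x, y) = g(x) - g(y)` and `G` square integrable for `|x - y|⁻ⁿ dσ(x) dσ(y)`, so that its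
inner product is
`∫ g h dσ + ∬ (g(x) - g(y)) (h(x) - h(y)) / |x - y|ⁿ dσ(x) dσ(y)`. -/
def Hhalf {n : ℕ} (Ω Γ : Set (E n)) :
    Submodule ℝ (WithLp 2 (Lp ℝ 2 ((surf Ω).restrict Γ) ×
      Lp ℝ 2 ((surfKernel Ω).restrict (Γ ×ˢ Γ)))) where
  carrier := {p | ∀ᵐ z ∂(surfKernel Ω).restrict (Γ ×ˢ Γ), p.snd z = p.fst z.1 - p.fst z.2}
  add_mem' := by
    intro p q hp hq
    filter_upwards [hp, hq, Lp.coeFn_add p.snd q.snd,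
      (quasi_fst Ω Γ).ae (Lp.coeFn_add p.fst q.fst),
      (quasi_snd Ω Γ).ae (Lp.coeFn_add p.fst q.fst)] with z h1 h2 h3 h4 h5
    rw [WithLp.add_snd, WithLp.add_fst, h3, h4, h5]
    simp only [Pi.add_apply, h1, h2]
    ring
  zero_mem' := by
    filter_upwards [Lp.coeFn_zero ℝ 2 ((surfKernel Ω).restrict (Γ ×ˢ Γ)),
      (quasi_fst Ω Γ).ae (Lp.coeFn_zero ℝ 2 ((surf Ω).restrict Γ)),
      (quasi_snd Ω Γ).ae (Lp.coeFn_zero ℝ 2 ((surf Ω).restrict Γ))] with z h3 h4 h5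
    rw [WithLp.zero_snd, WithLp.zero_fst, h3, h4, h5]
    simp
  smul_mem' := by
    intro c p hp
    filter_upwards [hp, Lp.coeFn_smul c p.snd,
      (quasi_fst Ω Γ).ae (Lp.coeFn_smul c p.fst),
      (quasi_snd Ω Γ).ae (Lp.coeFn_smul c p.fst)] with z h1 h3 h4 h5
    rw [WithLp.smul_snd, WithLp.smul_fst, h3, h4, h5]
    simp only [Pi.smul_apply, h1, smul_eq_mul]
    ring

instance {n : ℕ} (Ω Γ : Set (E n)) : InnerProductSpace ℝ (Hhalf Ω Γ) :=
  Submodule.innerProductSpace _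

/-- The function underlying an element of `H^{1/2}(Γ)`. -/
def bdryFn {n : ℕ} {Ω Γ : Set (E n)} (g : Hhalf Ω Γ) : Lp ℝ 2 ((surf Ω).restrict Γ) := g.1.fst

lemma exists_subseq_ae {α : Type*} [MeasurableSpace α] {μ : Measure α} {f : ℕ → Lp ℝ 2 μ}
    {g : Lp ℝ 2 μ} (h : Tendsto f atTop (𝓝 g)) :
    ∃ ns : ℕ → ℕ, StrictMono ns ∧ ∀ᵐ x ∂μ, Tendsto (fun k => f (ns k) x) atTop (𝓝 (g x)) :=
  (tendstoInMeasure_of_tendsto_Lp h).exists_seq_tendsto_ae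

/-- `H^{1/2}(Γ)` is a Hilbert space. -/
instance {n : ℕ} (Ω Γ : Set (E n)) : CompleteSpace (Hhalf Ω Γ) := by
  refine IsClosed.completeSpace_coe (hs := IsSeqClosed.isClosed ?_)
  intro f g hf hg
  have hg1 : Tendsto (fun k => (f k).fst) atTop (𝓝 g.fst) :=
    (((WithLp.continuous_fst 2 _ _)).tendsto g).comp hg
  have hg2 : Tendsto (fun k => (f k).snd) atTop (𝓝 g.snd) :=
    (((WithLp.continuous_snd 2 _ _)).tendsto g).comp hg
  obtain ⟨ns, hns, h1⟩ := exists_subseq_ae hg1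
  obtain ⟨ms, hms, h2⟩ := exists_subseq_ae (hg2.comp hns.tendsto_atTop)
  have hall : ∀ᵐ z ∂(surfKernel Ω).restrict (Γ ×ˢ Γ), ∀ k,
      (f k).snd z = (f k).fst z.1 - (f k).fst z.2 := ae_all_iff.2 fun k => hf k
  filter_upwards [hall, h2, (quasi_fst Ω Γ).ae h1, (quasi_snd Ω Γ).ae h1] with z ha hb hc hd
  refine tendsto_nhds_unique hb ?_
  simp only [Function.comp_apply, ha]
  exact (hc.comp hms.tendsto_atTop).sub (hd.comp hms.tendsto_atTop)

/-- The Hilbert space `(H^{1/2}(Γ))ⁿ`. -/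
abbrev HhalfN {n : ℕ} (Ω Γ : Set (E n)) : Type := PiLp 2 (fun _ : Fin n => Hhalf Ω Γ)

instance {n : ℕ} (Ω Γ : Set (E n)) : NormedAddCommGroup (HhalfN Ω Γ) := inferInstance

instance {n : ℕ} (Ω Γ : Set (E n)) : InnerProductSpace ℝ (HhalfN Ω Γ) :=
  PiLp.innerProductSpace _

/-- Restriction of `L²` functions to a smaller measure. -/
def restrictLp {α : Type*} [MeasurableSpace α] {μ ν : Measure α} (h : ν ≤ μ) (f : Lp ℝ 2 μ) :
    Lp ℝ 2 ν := ((Lp.memLp f).mono_measure h).toLp f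

lemma restrictLp_ae {α : Type*} [MeasurableSpace α] {μ ν : Measure α} (h : ν ≤ μ) (f : Lp ℝ 2 μ) :
    restrictLp h f =ᵐ[ν] f := MemLp.coeFn_toLp _

lemma restrictLp_add {α : Type*} [MeasurableSpace α] {μ ν : Measure α} (h : ν ≤ μ)
    (f g : Lp ℝ 2 μ) : restrictLp h (f + g) = restrictLp h f + restrictLp h g := by
  refine Lp.ext ?_
  filter_upwards [restrictLp_ae h (f + g), restrictLp_ae h f, restrictLp_ae h g,
    Lp.coeFn_add (restrictLp h f) (restrictLp h g),
    (Measure.absolutelyContinuous_of_le h).ae_le (Lp.coeFn_add f g)] with x h1 h2 h3 h4 h5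
  rw [h1, h4, h5, Pi.add_apply, Pi.add_apply, h2, h3]

lemma restrictLp_smul {α : Type*} [MeasurableSpace α] {μ ν : Measure α} (h : ν ≤ μ) (c : ℝ)
    (f : Lp ℝ 2 μ) : restrictLp h (c • f) = c • restrictLp h f := by
  refine Lp.ext ?_
  filter_upwards [restrictLp_ae h (c • f), restrictLp_ae h f,
    Lp.coeFn_smul c (restrictLp h f),
    (Measure.absolutelyContinuous_of_le h).ae_le (Lp.coeFn_smul c f)] with x h1 h2 h4 h5
  rw [h1, h4, h5, Pi.smul_apply, Pi.smul_apply, h2]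

lemma norm_restrictLp_le {α : Type*} [MeasurableSpace α] {μ ν : Measure α} (h : ν ≤ μ)
    (f : Lp ℝ 2 μ) : ‖restrictLp h f‖ ≤ ‖f‖ := by
  rw [restrictLp, Lp.norm_toLp, Lp.norm_def]
  exact ENNReal.toReal_mono (Lp.eLpNorm_ne_top f) (eLpNorm_mono_measure f h)

/-- Restriction of `L²` functions to a smaller measure, as a continuous linear map. -/
def restrictL {α : Type*} [MeasurableSpace α] {μ ν : Measure α} (h : ν ≤ μ) :
    Lp ℝ 2 μ →L[ℝ] Lp ℝ 2 ν :=
  LinearMap.mkContinuous ⟨⟨restrictLp h, restrictLp_add h⟩, restrictLp_smul h⟩ 1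
    fun f => by simpa using norm_restrictLp_le h f

lemma restrictL_ae {α : Type*} [MeasurableSpace α] {μ ν : Measure α} (h : ν ≤ μ) (f : Lp ℝ 2 μ) :
    restrictL h f =ᵐ[ν] f := restrictLp_ae h f

/-- Componentwise action of two continuous linear maps. -/
def prodMapL2 {F₁ F₂ G₁ G₂ : Type*} [NormedAddCommGroup F₁] [NormedSpace ℝ F₁]
    [NormedAddCommGroup F₂] [NormedSpace ℝ F₂] [NormedAddCommGroup G₁] [NormedSpace ℝ G₁]
    [NormedAddCommGroup G₂] [NormedSpace ℝ G₂] (S : F₁ →L[ℝ] G₁) (T : F₂ →L[ℝ] G₂) :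
    WithLp 2 (F₁ × F₂) →L[ℝ] WithLp 2 (G₁ × G₂) :=
  (WithLp.prodContinuousLinearEquiv 2 ℝ G₁ G₂).symm.toContinuousLinearMap ∘L
    (S.prodMap T ∘L (WithLp.prodContinuousLinearEquiv 2 ℝ F₁ F₂).toContinuousLinearMap)

/-- The restriction operator `χ_Γ : H^{1/2}(∂Ω) → H^{1/2}(Γ)` (in one component). -/
def restrictBdry {n : ℕ} {Ω Γ : Set (E n)} (hΓ : Γ ⊆ frontier Ω) :
    Hhalf Ω (frontier Ω) →L[ℝ] Hhalf Ω Γ :=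
  (prodMapL2 (restrictL (Measure.restrict_mono hΓ le_rfl))
      (restrictL (Measure.restrict_mono (Set.prod_mono hΓ hΓ) le_rfl)) ∘L
    (Hhalf Ω (frontier Ω)).subtypeL).codRestrict (Hhalf Ω Γ) fun g => by
      have h := ae_restrict_of_ae_restrict_of_subset (Set.prod_mono hΓ hΓ) g.2
      filter_upwards [h, restrictL_ae (Measure.restrict_mono (Set.prod_mono hΓ hΓ) le_rfl) g.1.snd,
        (quasi_fst Ω Γ).ae (restrictL_ae (Measure.restrict_mono hΓ le_rfl) g.1.fst),
        (quasi_snd Ω Γ).ae (restrictL_ae (Measure.restrict_mono hΓ le_rfl) g.1.fst)]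
        with z h1 h2 h3 h4
      exact h2.trans (h1.trans (congrArg₂ (· - ·) h3.symm h4.symm))

lemma bdryFn_restrictBdry {n : ℕ} {Ω Γ : Set (E n)} (hΓ : Γ ⊆ frontier Ω)
    (g : Hhalf Ω (frontier Ω)) :
    bdryFn (restrictBdry hΓ g) =ᵐ[(surf Ω).restrict Γ] bdryFn g :=
  restrictL_ae (Measure.restrict_mono hΓ le_rfl) g.1.fst

open Classical in
/-- The trace operator `γ₀ : H¹(Ω) → H^{1/2}(∂Ω)`: the bounded operator with `γ₀ φ = φ|_{∂Ω}` for
every smooth function `φ` on `ℝⁿ` with compact support. For a bounded open set with Lipschitz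
boundary it exists by the trace theorem, and it is unique since the restrictions of these `φ` are
dense in `H¹(Ω)`. -/
def trace {n : ℕ} (Ω : Set (E n)) : H1 Ω →L[ℝ] Hhalf Ω (frontier Ω) :=
  if h : ∃ γ : H1 Ω →L[ℝ] Hhalf Ω (frontier Ω), ∀ (u : H1 Ω) (φ : E n → ℝ), ContDiff ℝ ∞ φ →
      HasCompactSupport φ → fn u =ᵐ[volume.restrict Ω] φ →
      bdryFn (γ u) =ᵐ[(surf Ω).restrict (frontier Ω)] φ
  then h.choose else 0

/-- The trace operator `γ : (H¹(Ω))ⁿ → (H^{1/2}(∂Ω))ⁿ`. -/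
def traceN {n : ℕ} (Ω : Set (E n)) :
    PiLp 2 (fun _ : Fin n => H1 Ω) →L[ℝ] HhalfN Ω (frontier Ω) :=
  piMapL2 n (trace Ω)

/-- The restriction operator `χ_Γ : (H^{1/2}(∂Ω))ⁿ → (H^{1/2}(Γ))ⁿ`. -/
def restrictN {n : ℕ} {Ω Γ : Set (E n)} (hΓ : Γ ⊆ frontier Ω) :
    HhalfN Ω (frontier Ω) →L[ℝ] HhalfN Ω Γ :=
  piMapL2 n (restrictBdry hΓ)

/-! ### The Dirichlet realization of the elliptic operator and its semigroup -/

/-- `z = ∑ᵢⱼ ∂ᵢ (aᵢⱼ ∂ⱼ u)` on `Ω` in the weak sense. -/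
def IsEllipticImage {n : ℕ} {Ω : Set (E n)} (a : Fin n → Fin n → E n → ℝ) (u : H1 Ω) (z : L2 Ω) :
    Prop :=
  ∀ φ : E n → ℝ, IsTest Ω φ →
    ∑ i, ∑ j, ∫ x in Ω, deriv1 u j x * (a i j x * partialD i φ x) = -∫ x in Ω, z x * φ x

lemma IsEllipticImage.add {n : ℕ} {Ω : Set (E n)} {a : Fin n → Fin n → E n → ℝ}
    (ha : ∀ i j, ContDiff ℝ ∞ (a i j)) {u v : H1 Ω} {z w : L2 Ω} (h : IsEllipticImage a u z)
    (h' : IsEllipticImage a v w) : IsEllipticImage a (u + v) (z + w) := by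
  intro φ hφ
  have key : ∀ i j, ∫ x in Ω, deriv1 (u + v) j x * (a i j x * partialD i φ x)
      = (∫ x in Ω, deriv1 u j x * (a i j x * partialD i φ x))
        + ∫ x in Ω, deriv1 v j x * (a i j x * partialD i φ x) := by
    intro i j
    rw [deriv1_add]
    exact integral_add_cc (deriv1 u j) (deriv1 v j)
      ((ha i j).continuous.mul (hφ.continuous_partialD i)) (hφ.compact_partialD i).mul_left
  simp only [key, Finset.sum_add_distrib]
  rw [h φ hφ, h' φ hφ, integral_add_cc _ _ hφ.smooth.continuous hφ.compact]
  ring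

lemma IsEllipticImage.smul {n : ℕ} {Ω : Set (E n)} {a : Fin n → Fin n → E n → ℝ}
    (c : ℝ) {u : H1 Ω} {z : L2 Ω} (h : IsEllipticImage a u z) :
    IsEllipticImage a (c • u) (c • z) := by
  intro φ hφ
  have key : ∀ i j, ∫ x in Ω, deriv1 (c • u) j x * (a i j x * partialD i φ x)
      = c * ∫ x in Ω, deriv1 u j x * (a i j x * partialD i φ x) := by
    intro i j
    rw [deriv1_smul]
    exact integral_smul_cc c (deriv1 u j) _
  simp only [key, ← Finset.mul_sum]
  rw [h φ hφ, integral_smul_cc]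
  ring

lemma IsEllipticImage.zero {n : ℕ} {Ω : Set (E n)} (a : Fin n → Fin n → E n → ℝ) :
    IsEllipticImage a (0 : H1 Ω) 0 := by
  simpa only [zero_smul] using IsEllipticImage.smul (a := a) 0
    (u := (0 : H1 Ω)) (z := 0) (fun φ hφ => by
      have key : ∀ i j, ∫ x in Ω, deriv1 (0 : H1 Ω) j x * (a i j x * partialD i φ x) = 0 := by
        intro i j
        rw [deriv1_zero]
        exact integral_zero_cc _
      simp only [key, Finset.sum_const_zero]
      rw [integral_zero_cc, neg_zero])

/-- The graph of `x ↦ ∑ᵢⱼ ∂ᵢ (aᵢⱼ ∂ⱼ x)` in a space `X` of functions on `Ω` (the function given by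
`x : X` is `J x`): both `x` and its image are in `X`, and `x ∈ H²(Ω) ∩ H¹₀(Ω)`. -/
def ellipticGraph {n : ℕ} {Ω : Set (E n)} {X : Type*} [NormedAddCommGroup X]
    [InnerProductSpace ℝ X] (J : X →L[ℝ] L2 Ω) (a : Fin n → Fin n → E n → ℝ)
    (ha : ∀ i j, ContDiff ℝ ∞ (a i j)) : Submodule ℝ (X × X) where
  carrier := {p | ∃ u ∈ H10 Ω, fn u = J p.1 ∧ J p.1 ∈ (grad Ω).domain ∧
    IsEllipticImage a u (J p.2)}
  add_mem' := by
    rintro ⟨x, z⟩ ⟨y, w⟩ ⟨u, hu, hup, hp, h⟩ ⟨v, hv, hvq, hq, h'⟩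
    simp only at hup hp h hvq hq h'
    refine ⟨u + v, add_mem hu hv, ?_, ?_, ?_⟩
    · rw [fn_add, hup, hvq]
      exact (map_add J x y).symm
    · rw [show J ((x, z) + (y, w)).1 = J x + J y from map_add J x y]
      exact add_mem hp hq
    · rw [show J ((x, z) + (y, w)).2 = J z + J w from map_add J z w]
      exact h.add ha h'
  zero_mem' := by
    refine ⟨0, zero_mem _, ?_, ?_, ?_⟩
    · rw [fn_zero]
      exact (map_zero J).symm
    · rw [show J (0 : X × X).1 = 0 from map_zero J]
      exact zero_mem _
    · rw [show J (0 : X × X).2 = 0 from map_zero J]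
      exact .zero a
  smul_mem' := by
    rintro c ⟨x, z⟩ ⟨u, hu, hup, hp, h⟩
    simp only at hup hp h
    refine ⟨c • u, Submodule.smul_mem _ c hu, ?_, ?_, ?_⟩
    · rw [fn_smul, hup]
      exact (map_smul J c x).symm
    · rw [show J (c • (x, z)).1 = c • J x from map_smul J c x]
      exact Submodule.smul_mem _ c hp
    · rw [show J (c • (x, z)).2 = c • J z from map_smul J c z]
      exact h.smul c

/-- The operator `A = ∑ᵢⱼ ∂ᵢ (aᵢⱼ ∂ⱼ ·)` in `X` with the Dirichlet boundary condition; its domain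
is the set of the `x ∈ X ∩ H²(Ω) ∩ H¹₀(Ω)` with `A x ∈ X`. -/
def ellipticOp {n : ℕ} {Ω : Set (E n)} {X : Type*} [NormedAddCommGroup X]
    [InnerProductSpace ℝ X] (J : X →L[ℝ] L2 Ω) (a : Fin n → Fin n → E n → ℝ)
    (ha : ∀ i j, ContDiff ℝ ∞ (a i j)) : X →ₗ.[ℝ] X :=
  (ellipticGraph J a ha).toLinearPMap

/-- `(S(t))_{t ≥ 0}` is a strongly continuous semigroup. -/
structure IsC0Semigroup {X : Type*} [NormedAddCommGroup X] [InnerProductSpace ℝ X]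
    (S : ℝ≥0 → X →L[ℝ] X) : Prop where
  zero : S 0 = ContinuousLinearMap.id ℝ X
  add : ∀ s t, S (s + t) = (S s).comp (S t)
  cont : ∀ x, Continuous fun t => S t x

/-- `A` is the infinitesimal generator of `S`. -/
def IsGenerator {X : Type*} [NormedAddCommGroup X] [InnerProductSpace ℝ X]
    (S : ℝ≥0 → X →L[ℝ] X) (A : X →ₗ.[ℝ] X) : Prop :=
  ∀ x z : X, (x, z) ∈ A.graph ↔
    Tendsto (fun h : ℝ≥0 => (h : ℝ)⁻¹ • (S h x - x)) (𝓝[>] 0) (𝓝 z)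

/-- `A` has a compact resolvent. -/
def HasCompactResolvent {X : Type*} [NormedAddCommGroup X] [InnerProductSpace ℝ X]
    (A : X →ₗ.[ℝ] X) : Prop :=
  ∃ (μ : ℝ) (R : X →L[ℝ] X), IsCompactOperator R ∧
    (∀ x, ∃ h : R x ∈ A.domain, μ • R x - A ⟨R x, h⟩ = x) ∧
    ∀ x : A.domain, R (μ • (x : X) - A x) = x

/-- The autonomous parabolic system `∂x/∂t = A x` on `Ω` with `x = 0` on `∂Ω`, in a Hilbert space
`X` of functions on `Ω` that is continuously embedded in `L²(Ω)`. -/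
structure ParabolicSystem {n : ℕ} (Ω : Set (E n)) (X : Type*) [NormedAddCommGroup X]
    [InnerProductSpace ℝ X] [CompleteSpace X] where
  /-- The coefficients of the operator. -/
  a : Fin n → Fin n → E n → ℝ
  smooth : ∀ i j, ContDiff ℝ ∞ (a i j)
  elliptic : ∃ α > 0, ∀ x ∈ Ω, ∀ v : E n, α * ∑ j, v j ^ 2 ≤ ∑ i, ∑ j, a i j x * v i * v j
  /-- The embedding of the state space in `L²(Ω)`. -/
  J : X →L[ℝ] L2 Ω
  J_injective : Function.Injective J
  selfAdjoint : IsSelfAdjoint (ellipticOp J a smooth)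
  compactResolvent : HasCompactResolvent (ellipticOp J a smooth)
  /-- The semigroup generated by the operator. -/
  S : ℝ≥0 → X →L[ℝ] X
  semigroup : IsC0Semigroup S
  generator : IsGenerator S (ellipticOp J a smooth)

namespace ParabolicSystem

/-- The operator `A` of the system. -/
def A {n : ℕ} {Ω : Set (E n)} {X : Type*} [NormedAddCommGroup X] [InnerProductSpace ℝ X]
    [CompleteSpace X] (P : ParabolicSystem Ω X) : X →ₗ.[ℝ] X :=
  ellipticOp P.J P.a P.smooth

end ParabolicSystem

/-! ### Sensors and observability -/

/-- A sensor `(D, f)`: a nonempty set `D ⊆ Ω̄` and a distribution `f` of the measurements on `D`,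
that is, a linear functional on the states `x ∈ D(A)`, continuous for the graph norm, with
`f x = 0` if `x` vanishes in a neighbourhood of `D`. It is `f x = ∫_D x f` for a zone sensor and
`f x = x(b)` for a pointwise sensor. -/
structure Sensor {n : ℕ} {Ω : Set (E n)} {X : Type*} [NormedAddCommGroup X]
    [InnerProductSpace ℝ X] [CompleteSpace X] (P : ParabolicSystem Ω X) where
  /-- The spatial support of the sensor. -/
  D : Set (E n)
  D_nonempty : D.Nonempty
  D_subset : D ⊆ closure Ω
  /-- The distribution of the measurements. -/
  f : P.A.domain →ₗ[ℝ] ℝ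
  bounded : ∃ M : ℝ, ∀ x : P.A.domain, |f x| ≤ M * (‖(x : X)‖ + ‖P.A x‖)
  local_on : ∀ x : P.A.domain, ∀ U : Set (E n), IsOpen U → D ⊆ U →
    (∀ᵐ ξ ∂volume.restrict Ω, ξ ∈ U → P.J x ξ = 0) → f x = 0

/-- The observation space `𝒪 = L²(0, T; ℝ^q)`. -/
abbrev Obs (q : ℕ) (T : ℝ) :=
  Lp (EuclideanSpace ℝ (Fin q)) 2 ((volume : Measure ℝ).restrict (Ioo 0 T))

section Observation

variable {n : ℕ} {Ω : Set (E n)} {X : Type*} [NormedAddCommGroup X]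
  [InnerProductSpace ℝ X] [CompleteSpace X] {P : ParabolicSystem Ω X} {q : ℕ}

/-- `K x = C S(·) x` on `(0, T)` for `x ∈ D(A)`, where `C x = (f₁ x, …, f_q x)`. As `D(A)` is dense
in `X`, there is at most one such bounded operator `K`. -/
def IsOutputMap (c : Fin q → Sensor P) (T : ℝ) (K : X →L[ℝ] Obs q T) : Prop :=
  ∀ x : P.A.domain, ∀ᵐ t ∂(volume : Measure ℝ).restrict (Ioo 0 T), ∀ i,
    ∃ h : P.S t.toNNReal x ∈ P.A.domain, K x t i = (c i).f ⟨P.S t.toNNReal x, h⟩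

/-- The output of the system along the sensors is a bounded operator from `X` to `𝒪`. It holds if
`C` is bounded on `X`. -/
def Admissible (c : Fin q → Sensor P) (T : ℝ) : Prop := ∃ K : X →L[ℝ] Obs q T, IsOutputMap c T K

open Classical in
/-- The output operator `K : X → 𝒪`, `K x = C S(·) x`. -/
def outputMap (c : Fin q → Sensor P) (T : ℝ) : X →L[ℝ] Obs q T :=
  if h : Admissible c T then h.choose else 0

/-- The operator `H = χ_Γ γ ∇ K*` from `𝒪` to `(H^{1/2}(Γ))ⁿ`, defined for the `y ∈ 𝒪` with
`K* y ∈ H²(Ω)`, that is, with `∇ K* y ∈ (H¹(Ω))ⁿ`. -/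
def opH (c : Fin q → Sensor P) (T : ℝ) {Γ : Set (E n)} (hΓ : Γ ⊆ frontier Ω) :
    Obs q T →ₗ.[ℝ] HhalfN Ω Γ :=
  (restrictN hΓ ∘L traceN Ω).toLinearMap.compPMap (compPMap (grad Ω)
    ((P.J ∘L ContinuousLinearMap.adjoint (outputMap c T)).toLinearMap.toPMap ⊤))

/-- The system observed through the sensors on `[0, T]` is weakly regionally boundary gradient
observable on `Γ`: the closure of the image of `H` is `(H^{1/2}(Γ))ⁿ`. -/
def WeaklyObservable (c : Fin q → Sensor P) (T : ℝ) {Γ : Set (E n)} (hΓ : Γ ⊆ frontier Ω) : Prop :=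
  closure (range (opH c T hΓ)) = univ

/-- The sensors are boundary gradient strategic on `Γ`. -/
def IsStrategic (c : Fin q → Sensor P) (T : ℝ) {Γ : Set (E n)} (hΓ : Γ ⊆ frontier Ω) : Prop :=
  WeaklyObservable c T hΓ

end Observation

/-! ### Positive definite operators -/

/-- `N` is positive definite: it is symmetric and `⟪N x, x⟫ > 0` for each `x ≠ 0` in its domain. -/
def IsPosDef {G : Type*} [NormedAddCommGroup G] [InnerProductSpace ℝ G] (N : G →ₗ.[ℝ] G) : Prop :=
  (∀ x y : N.domain, ⟪N x, (y : G)⟫_ℝ = ⟪(x : G), N y⟫_ℝ) ∧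
    ∀ x : N.domain, (x : G) ≠ 0 → 0 < ⟪N x, (x : G)⟫_ℝ

/-- The operator `N_Γ = H H*`, where `H*` is the adjoint of `H`. -/
def opN {n : ℕ} {Ω : Set (E n)} {X : Type*} [NormedAddCommGroup X]
    [InnerProductSpace ℝ X] [CompleteSpace X] {P : ParabolicSystem Ω X} {q : ℕ}
    (c : Fin q → Sensor P) (T : ℝ) {Γ : Set (E n)} (hΓ : Γ ⊆ frontier Ω) :
    HhalfN Ω Γ →ₗ.[ℝ] HhalfN Ω Γ :=
  compPMap (opH c T hΓ) (opH c T hΓ)†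

end BoundaryGradient

/-!
Let `K* = (outputMap c T)*`, so that `D(H) = {y | K* y ∈ H²(Ω)}`.

*Density of `D(H)`.* Since `D(A) ⊆ H²(Ω)`, it is enough to have `K* y ∈ D(A)` for the
`y(t) = φ(t) v` with a test function `φ` on `(0, T)` and `v ∈ ℝ^q`, which span a dense subspace of
`𝒪` (`dense_of_testObs_mem`). For `x ∈ D(A)` the output of `S(s) x` is the translate by `s` of the
output of `x` (`IsOutputMap.apply_semigroup`), so the difference quotients of `s ↦ ⟪K S(s) x, y⟫` at `0` can be
moved to `y` as soon as `s` is less than the distance of the support of `y` to the ends of the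
interval. In the limit `⟪K A x, y⟫ = -⟪K x, y'⟫` (`IsOutputMap.inner_generator`), that is,
`⟪A x, K* y⟫ = ⟪x, -K* y'⟫`. Hence `K* y ∈ D(A*)`, and `A* = A`.

*The equivalence.* It holds for every densely defined operator `B` between Hilbert spaces
(`closure_range_eq_univ_iff_isPosDef`). The formula `⟪B B* x, y⟫ = ⟪B* x, B* y⟫` shows that `B B*`
is symmetric and that it is positive definite if `B*` is injective; conversely, the kernel of `B*`
is contained in the domain of `B B*`, which vanishes there, so it is trivial if `B B*` is positive
definite. The kernel of `B*` is the orthogonal complement of the image of `B`.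
-/

namespace BoundaryGradient

/-! ### The operator `B B*` -/

section PositiveDefinite

variable {F G : Type*} [NormedAddCommGroup F] [InnerProductSpace ℝ F] [CompleteSpace F]
  [NormedAddCommGroup G] [InnerProductSpace ℝ G]

lemma compPMap_adjoint_inner {B : F →ₗ.[ℝ] G} (hB : Dense (B.domain : Set F))
    (x : (compPMap B B†).domain) (y : B†.domain) :
    ⟪compPMap B B† x, (y : G)⟫_ℝ = ⟪B† ⟨x, x.2.choose⟩, B† y⟫_ℝ := by
  rw [real_inner_comm, real_inner_comm (B† y)]
  exact (B.adjoint_isFormalAdjoint hB y ⟨B† ⟨x, x.2.choose⟩, x.2.choose_spec⟩).symm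

/-- An element orthogonal to the image of `B` lies in the kernel of `B*`, hence in that of
`B B*`. -/
lemma exists_compPMap_adjoint_eq_zero {B : F →ₗ.[ℝ] G} (hB : Dense (B.domain : Set F)) {g : G}
    (hg : ∀ x : B.domain, ⟪g, B x⟫_ℝ = 0) :
    ∃ h : g ∈ (compPMap B B†).domain, compPMap B B† ⟨g, h⟩ = 0 := by
  have h0 : ∀ x : B.domain, ⟪(0 : F), (x : F)⟫_ℝ = ⟪g, B x⟫_ℝ := fun x => by
    rw [inner_zero_left, hg]
  have hd : g ∈ B†.domain := B.mem_adjoint_domain_of_exists g ⟨0, h0⟩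
  have hz : B† ⟨g, hd⟩ = 0 := LinearPMap.adjoint_apply_eq hB ⟨g, hd⟩ h0
  have hm : g ∈ (compPMap B B†).domain := ⟨hd, hz ▸ zero_mem _⟩
  refine ⟨hm, ?_⟩
  have h1 : (⟨B† ⟨g, hm.choose⟩, hm.choose_spec⟩ : B.domain) = 0 := Subtype.ext hz
  exact (congrArg B h1).trans B.map_zero

/-- A densely defined operator `B` has dense image if and only if `B B*` is positive definite: both
mean that `B*` is injective. -/
lemma closure_range_eq_univ_iff_isPosDef [CompleteSpace G] {B : F →ₗ.[ℝ] G}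
    (hB : Dense (B.domain : Set F)) :
    closure (range B) = univ ↔ IsPosDef (compPMap B B†) := by
  constructor
  · refine fun hd => ⟨fun x y => ?_, fun x hx => ?_⟩
    · rw [compPMap_adjoint_inner hB x ⟨y, y.2.choose⟩, real_inner_comm _ (x : G),
        compPMap_adjoint_inner hB y ⟨x, x.2.choose⟩, real_inner_comm]
    · rw [compPMap_adjoint_inner hB x ⟨x, x.2.choose⟩, real_inner_self_pos]
      refine fun h0 => hx ((dense_iff_closure_eq.2 hd).eq_zero_of_inner_left (𝕜 := ℝ) ?_)
      rintro _ ⟨y, rfl⟩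
      rw [← B.adjoint_isFormalAdjoint hB ⟨x, x.2.choose⟩ y, h0, inner_zero_left]
  · intro hN
    have hr : range B = (LinearMap.range B.toFun : Set G) := rfl
    rw [hr, ← dense_iff_closure_eq, Submodule.dense_iff_topologicalClosure_eq_top,
      Submodule.topologicalClosure_eq_top_iff, Submodule.eq_bot_iff]
    intro g hg
    obtain ⟨hm, h0⟩ := exists_compPMap_adjoint_eq_zero hB (g := g) fun x =>
      (Submodule.mem_orthogonal' _ _).1 hg _ (LinearMap.mem_range_self B.toFun x)
    by_contra hne
    have hpos := hN.2 ⟨g, hm⟩ hne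
    rw [h0, inner_zero_left] at hpos
    exact lt_irrefl _ hpos

end PositiveDefinite

/-! ### Test functions in the observation space -/

lemma memLp_smul_const {q : ℕ} (T : ℝ) {φ : ℝ → ℝ} (hc : Continuous φ) (hs : HasCompactSupport φ)
    (v : EuclideanSpace ℝ (Fin q)) :
    MemLp (fun t => φ t • v) 2 ((volume : Measure ℝ).restrict (Ioo 0 T)) :=
  ((hc.smul continuous_const).memLp_of_hasCompactSupport
    (hs.smul_right (f' := fun _ => v))).restrict _

/-- The observation `t ↦ φ(t) v` for a continuous function `φ` with compact support. -/
def testObs {q : ℕ} (T : ℝ) {φ : ℝ → ℝ} (hc : Continuous φ) (hs : HasCompactSupport φ)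
    (v : EuclideanSpace ℝ (Fin q)) : Obs q T :=
  (memLp_smul_const T hc hs v).toLp

lemma testObs_ae {q : ℕ} (T : ℝ) {φ : ℝ → ℝ} (hc : Continuous φ) (hs : HasCompactSupport φ)
    (v : EuclideanSpace ℝ (Fin q)) :
    testObs T hc hs v =ᵐ[(volume : Measure ℝ).restrict (Ioo 0 T)] fun t => φ t • v :=
  MemLp.coeFn_toLp _

lemma integral_eq_inner_testObs {q : ℕ} {T : ℝ} {φ : ℝ → ℝ} (hc : Continuous φ)
    (hs : HasCompactSupport φ) (v : EuclideanSpace ℝ (Fin q)) (u : Obs q T) :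
    ⟪u, testObs T hc hs v⟫_ℝ = ∫ t, (Ioo 0 T).indicator (fun t => ⟪u t, v⟫_ℝ) t * φ t := by
  rw [L2.inner_def]
  simp only [← indicator_mul_left]
  rw [integral_indicator measurableSet_Ioo]
  refine integral_congr_ae ?_
  filter_upwards [testObs_ae T hc hs v] with t ht
  rw [ht, inner_smul_right, mul_comm]

lemma integrable_indicator_inner {q : ℕ} {T : ℝ} (u : Obs q T) (v : EuclideanSpace ℝ (Fin q)) :
    Integrable ((Ioo 0 T).indicator fun t => ⟪u t, v⟫_ℝ) :=
  (integrable_indicator_iff measurableSet_Ioo).2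
    (((Lp.memLp u).integrable one_le_two).inner_const v)

/-- A subspace of `L²(0, T; ℝ^q)` that contains `t ↦ φ(t) v` for each test function `φ` on `(0, T)`
and each vector `v` is dense. -/
lemma dense_of_testObs_mem {q : ℕ} {T : ℝ} (p : Submodule ℝ (Obs q T))
    (hp : ∀ (φ : ℝ → ℝ) (h : ContDiff ℝ ∞ φ) (hs : HasCompactSupport φ), tsupport φ ⊆ Ioo 0 T →
      ∀ v, testObs T h.continuous hs v ∈ p) : Dense (p : Set (Obs q T)) := by
  rw [Submodule.dense_iff_topologicalClosure_eq_top, Submodule.topologicalClosure_eq_top_iff,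
    Submodule.eq_bot_iff]
  intro u hu
  have hi : Integrable u ((volume : Measure ℝ).restrict (Ioo 0 T)) :=
    (Lp.memLp u).integrable one_le_two
  have h0 := isOpen_Ioo.ae_eq_zero_of_integral_contDiff_smul_eq_zero (U := Ioo 0 T)
    (μ := (volume : Measure ℝ).restrict (Ioo 0 T)) (f := u)
    (hi.locallyIntegrable.locallyIntegrableOn _) ?_
  · refine (Lp.eq_zero_iff_ae_eq_zero).2 ?_
    filter_upwards [h0, ae_restrict_mem measurableSet_Ioo] with t h1 h2 using h1 h2
  · intro φ h hs hsub
    refine ext_inner_right ℝ fun v => ?_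
    have h1 := (Submodule.mem_orthogonal' _ _).1 hu _ (hp φ h hs hsub v)
    rw [L2.inner_def] at h1
    have h2 : Integrable (fun t => φ t • u t) ((volume : Measure ℝ).restrict (Ioo 0 T)) := by
      obtain ⟨C, hC⟩ := hs.exists_bound_of_continuous h.continuous
      exact hi.bdd_smul C h.continuous.aestronglyMeasurable (Eventually.of_forall hC)
    rw [inner_zero_left, real_inner_comm, ← integral_inner h2]
    refine (integral_congr_ae ?_).trans h1
    filter_upwards [testObs_ae T h.continuous hs v] with t ht
    rw [ht, inner_smul_right, inner_smul_right, real_inner_comm]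

/-- The derivative at `0` of the translates: `h ↦ ∫ g(t) φ(t - h) dt` has derivative
`-∫ g φ'`. -/
lemma hasDerivAt_integral_translate {g φ : ℝ → ℝ} (hg : Integrable g) (h : ContDiff ℝ ∞ φ)
    (hs : HasCompactSupport φ) :
    HasDerivAt (fun s => ∫ t, g t * φ (t - s)) (-∫ t, g t * deriv φ t) 0 := by
  -- This is the convolution of `g` with the reflection of `φ`.
  have hcd : ContDiff ℝ 1 fun t => φ (-t) := (h.comp contDiff_neg).of_le (by simp)
  have := HasCompactSupport.hasDerivAt_convolution_right (ContinuousLinearMap.mul ℝ ℝ)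
    hg.locallyIntegrable (hs.comp_homeomorph (Homeomorph.neg ℝ)) hcd 0
  have hd : deriv (φ ∘ Homeomorph.neg ℝ) = fun t => -deriv φ (-t) := by
    ext t
    exact deriv_comp_neg φ t
  rw [hd] at this
  have hc : (fun s => ∫ t, g t * φ (t - s)) =
      convolution g (φ ∘ Homeomorph.neg ℝ) (ContinuousLinearMap.mul ℝ ℝ) volume := by
    ext s
    simp [convolution_def]
  rw [hc]
  simpa [convolution_def, integral_neg] using this

/-! ### The adjoint of the output map -/

variable {n : ℕ} {Ω : Set (E n)} {X : Type*} [NormedAddCommGroup X]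
  [InnerProductSpace ℝ X] [CompleteSpace X] {P : ParabolicSystem Ω X} {q : ℕ}

lemma ParabolicSystem.tendsto_generator (P : ParabolicSystem Ω X) (x : P.A.domain) :
    Tendsto (fun h : ℝ≥0 => (h : ℝ)⁻¹ • (P.S h x - x)) (𝓝[>] 0) (𝓝 (P.A x)) :=
  (P.generator x (P.A x)).1 (P.A.mem_graph x)

lemma ParabolicSystem.semigroup_mem_domain (P : ParabolicSystem Ω X) (s : ℝ≥0) (x : P.A.domain) :
    P.S s x ∈ P.A.domain := by
  refine LinearPMap.mem_domain_of_mem_graph ((P.generator _ (P.S s (P.A x))).2 ?_)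
  refine (((P.S s).continuous.tendsto _).comp (P.tendsto_generator x)).congr fun h => ?_
  simp only [Function.comp_apply, map_smul, map_sub]
  rw [← ContinuousLinearMap.comp_apply, ← P.semigroup.add, add_comm, P.semigroup.add,
    ContinuousLinearMap.comp_apply]

/-- The output of the state `S(s) x` is the translate by `s` of the output of `x`. -/
lemma IsOutputMap.apply_semigroup {c : Fin q → Sensor P} {T : ℝ} {K : X →L[ℝ] Obs q T}
    (hK : IsOutputMap c T K) (s : ℝ≥0) (x : P.A.domain) :
    ∀ᵐ t : ℝ, t ∈ Ioo 0 T → t + s ∈ Ioo 0 T → K (P.S s x) t = K x (t + s) := by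
  have h1 := (ae_restrict_iff' measurableSet_Ioo).1 (hK x)
  have h2 := (ae_restrict_iff' measurableSet_Ioo).1 (hK ⟨P.S s x, P.semigroup_mem_domain s x⟩)
  filter_upwards [h2, (measurePreserving_add_right volume (s : ℝ)).quasiMeasurePreserving.ae h1]
    with t h2 h1 ht hts
  ext i
  obtain ⟨m1, e1⟩ := h1 hts i
  obtain ⟨m2, e2⟩ := h2 ht i
  have hS : P.S (t + s).toNNReal x = P.S t.toNNReal (P.S s x) := by
    rw [Real.toNNReal_add ht.1.le s.coe_nonneg, Real.toNNReal_coe, P.semigroup.add,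
      ContinuousLinearMap.comp_apply]
  rw [e1, e2]
  congr 2
  exact hS.symm

/-- For a small translation `s`, the output of `S(s) x` tested against `φ v` is the output of `x`
tested against the translate of `φ v`, which is still supported in `(0, T)`. -/
lemma IsOutputMap.inner_semigroup_eventually {c : Fin q → Sensor P} {T : ℝ} {K : X →L[ℝ] Obs q T}
    (hK : IsOutputMap c T K) (x : P.A.domain) {φ : ℝ → ℝ} (hc : Continuous φ)
    (hs : HasCompactSupport φ) (hsub : tsupport φ ⊆ Ioo 0 T) (v : EuclideanSpace ℝ (Fin q)) :
    ∀ᶠ s : ℝ≥0 in 𝓝 0, ⟪K (P.S s x), testObs T hc hs v⟫_ℝ =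
      ∫ t, (Ioo 0 T).indicator (fun t => ⟪K x t, v⟫_ℝ) t * φ (t - s) := by
  obtain ⟨δ, hδ, hthick⟩ := hs.isCompact.exists_thickening_subset_open isOpen_Ioo hsub
  filter_upwards [gt_mem_nhds (show (0 : ℝ≥0) < ⟨δ, hδ.le⟩ from hδ)] with s hsδ
  rw [integral_eq_inner_testObs, ← integral_add_right_eq_self
    (fun t => (Ioo 0 T).indicator (fun t => ⟪K x t, v⟫_ℝ) t * φ (t - s)) (s : ℝ)]
  refine integral_congr_ae ?_
  filter_upwards [hK.apply_semigroup s x] with t ht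
  rw [add_sub_cancel_right]
  by_cases h0 : φ t = 0
  · rw [h0, mul_zero, mul_zero]
  · have hts : t ∈ tsupport φ := subset_tsupport φ h0
    have hm : t + s ∈ Ioo 0 T := hthick <| Metric.mem_thickening_iff.2
      ⟨t, hts, by simpa [Real.dist_eq] using (show (s : ℝ) < δ from hsδ)⟩
    rw [indicator_of_mem (hsub hts), indicator_of_mem hm, ht (hsub hts) hm]

/-- In the weak sense, `A K* y = -K* y'` for `y = φ v` with a test function `φ` on `(0, T)`:
by the translation property of the output, `A` acts on it as the time derivative, which is moved
to `y`. -/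
lemma IsOutputMap.inner_generator {c : Fin q → Sensor P} {T : ℝ} {K : X →L[ℝ] Obs q T}
    (hK : IsOutputMap c T K) (x : P.A.domain) {φ : ℝ → ℝ} (h : ContDiff ℝ ∞ φ)
    (hs : HasCompactSupport φ) (hsub : tsupport φ ⊆ Ioo 0 T) (v : EuclideanSpace ℝ (Fin q)) :
    ⟪K (P.A x), testObs T h.continuous hs v⟫_ℝ =
      -⟪K x, testObs T (h.continuous_deriv (by simp)) hs.deriv v⟫_ℝ := by
  set y := testObs T h.continuous hs v
  have hev := hK.inner_semigroup_eventually x h.continuous hs hsub v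
  have h0 := hev.self_of_nhds
  have hlim : Tendsto (fun s : ℝ≥0 => ⟪K ((s : ℝ)⁻¹ • (P.S s x - x)), y⟫_ℝ) (𝓝[>] 0)
      (𝓝 ⟪K (P.A x), y⟫_ℝ) :=
    ((K.continuous.inner continuous_const).tendsto _).comp (P.tendsto_generator x)
  refine tendsto_nhds_unique hlim ?_
  rw [integral_eq_inner_testObs]
  have hcoe : Tendsto ((↑) : ℝ≥0 → ℝ) (𝓝[>] 0) (𝓝[>] 0) :=
    tendsto_nhdsWithin_iff.2 ⟨(NNReal.continuous_coe.tendsto' 0 0 rfl).mono_left nhdsWithin_le_nhds,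
      eventually_nhdsWithin_of_forall fun s hs => NNReal.coe_pos.2 hs⟩
  refine (((hasDerivAt_integral_translate (integrable_indicator_inner (K x) v) h
    hs).tendsto_slope_zero_right).comp hcoe).congr' ?_
  filter_upwards [nhdsWithin_le_nhds hev] with s hs
  rw [P.semigroup.zero] at h0
  simp only [NNReal.coe_zero, ContinuousLinearMap.id_apply] at h0
  simp only [Function.comp_apply, zero_add, map_smul, map_sub, inner_smul_left, inner_sub_left,
    ← hs, y, h0]
  simp

/-- `K* y ∈ D(A)` for `y = φ v` with a test function `φ` on `(0, T)`, by the self-adjointness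
of `A`. -/
lemma IsOutputMap.adjoint_testObs_mem_domain {c : Fin q → Sensor P} {T : ℝ} {K : X →L[ℝ] Obs q T}
    (hK : IsOutputMap c T K) {φ : ℝ → ℝ} (h : ContDiff ℝ ∞ φ) (hs : HasCompactSupport φ)
    (hsub : tsupport φ ⊆ Ioo 0 T) (v : EuclideanSpace ℝ (Fin q)) :
    ContinuousLinearMap.adjoint K (testObs T h.continuous hs v) ∈ P.A.domain := by
  have hsa : P.A† = P.A := P.selfAdjoint
  rw [← hsa]
  refine P.A.mem_adjoint_domain_of_exists _ ⟨-ContinuousLinearMap.adjoint K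
    (testObs T (h.continuous_deriv (by simp)) hs.deriv v), fun x => ?_⟩
  rw [inner_neg_left, ContinuousLinearMap.adjoint_inner_left, ContinuousLinearMap.adjoint_inner_left,
    real_inner_comm, real_inner_comm (K (P.A x)), hK.inner_generator x h hs hsub v]

lemma ParabolicSystem.J_mem_grad_domain (P : ParabolicSystem Ω X) {x : X} (hx : x ∈ P.A.domain) :
    P.J x ∈ (grad Ω).domain := by
  obtain ⟨p, ⟨u, -, -, hp, -⟩, rfl⟩ := hx
  exact hp

lemma isOutputMap_outputMap {c : Fin q → Sensor P} {T : ℝ} (hc : Admissible c T) :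
    IsOutputMap c T (outputMap c T) := by
  rw [outputMap, dif_pos hc]
  exact hc.choose_spec

lemma dense_opH_domain {c : Fin q → Sensor P} {T : ℝ} (hc : Admissible c T) {Γ : Set (E n)}
    (hΓ : Γ ⊆ frontier Ω) : Dense ((opH c T hΓ).domain : Set (Obs q T)) :=
  dense_of_testObs_mem _ fun _ h hs hsub v =>
    ⟨trivial, P.J_mem_grad_domain
      ((isOutputMap_outputMap hc).adjoint_testObs_mem_domain h hs hsub v)⟩

end BoundaryGradient

theorem corollary3p4 {n : ℕ} (hn : 0 < n) {Ω : Set (BoundaryGradient.E n)} (hΩ : IsOpen Ω)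
    (hΩb : Bornology.IsBounded Ω) (hΩL : BoundaryGradient.HasLipschitzBoundary Ω)
    {Γ : Set (BoundaryGradient.E n)} (hΓ : Γ ⊆ frontier Ω) (hΓm : MeasurableSet Γ)
    {X : Type*} [NormedAddCommGroup X] [InnerProductSpace ℝ X] [CompleteSpace X]
    (P : BoundaryGradient.ParabolicSystem Ω X) {q : ℕ} (c : Fin q → BoundaryGradient.Sensor P)
    {T : ℝ} (hT : 0 < T) (hc : BoundaryGradient.Admissible c T) :
    Dense ((BoundaryGradient.opH c T hΓ).domain : Set (BoundaryGradient.Obs q T)) ∧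
      (BoundaryGradient.IsStrategic c T hΓ ↔
        BoundaryGradient.IsPosDef (BoundaryGradient.opN c T hΓ)) := by
  have hd := BoundaryGradient.dense_opH_domain hc hΓ
  exact ⟨hd, BoundaryGradient.closure_range_eq_univ_iff_isPosDef hd⟩
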